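/- Theorem (the set $S$). Let $s\ge 2$ be an integer, $\mathcal A_s=\{0,1,\dots,s-1\}$, and let $q_0,\dots,q_{s-1}$ be positive real numbers with $q_0+\dots+q_{s-1}=1$. Put $\beta_j=q_0+\dots+q_{j-1}$ for $j\in\mathcal A_s$ (so $\beta_0=0$). A $Q_s$-representation of $x\in[0,1]$ is a sequence $(\alpha_k)_{k\ge1}$ in $\mathcal A_s$ with $$x=\beta_{\alpha_1}+\sum_{k=2}^{\infty}\Bigl(\beta_{\alpha_k}\prod_{j=1}^{k-1}q_{\alpha_j}\Bigr).$$ Every $x\in[0,1]$ has one or two such representations, and if it has two, exactly one of them ends in zeros. The $Q_s$-digits $\alpha_k(x)$ of $x$ are those of its unique representation or, if there are two, of the one that ends in zeros. Let $S$ be the set of all $x\in[0,1]$ for which the sequence $\frac1n\sum_{i=1}^n\alpha_i(x)$ does not converge as $n\to\infty$. Then $S$ has the cardinality of the continuum, $S$ is dense in $[0,1]$, $S$ contains no interval $(a,b)$ with $a<b$, $S$ has Lebesgue measure zero, and the Hausdorff (Hausdorff–Besicovitch) dimension of $S$ equals $1$. -/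

import Mathlib

/-- `β_j = q_0 + ⋯ + q_{j-1}` (so that `β_0 = 0`), for a digit `j` of the alphabet `{0, …, s-1}`. -/
noncomputable def qsBeta {s : ℕ} (q : Fin s → ℝ) (j : Fin s) : ℝ :=
  ∑ i ∈ Finset.Iio j, q i

/-- The digit sequence `α` is a `Q_s`-representation of the real number `x`:
`x = β_{α_1} + ∑_{k ≥ 2} β_{α_k} q_{α_1} ⋯ q_{α_{k-1}}`.
The digits are indexed from `0` here, so `α k` is the digit `α_{k+1}`. -/
def IsQsRepresentation {s : ℕ} (q : Fin s → ℝ) (x : ℝ) (α : ℕ → Fin s) : Prop :=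
  HasSum (fun k : ℕ => qsBeta q (α k) * ∏ j ∈ Finset.range k, q (α j)) x

/-- The digit sequence `α` is the sequence of `Q_s`-digits of `x`: it is a `Q_s`-representation
of `x`, and if `x` has a second representation, then `α` is the one with period `(0)`. -/
def IsQsDigits {s : ℕ} (q : Fin s → ℝ) (x : ℝ) (α : ℕ → Fin s) : Prop :=
  IsQsRepresentation q x α ∧
    ((∃ γ : ℕ → Fin s, γ ≠ α ∧ IsQsRepresentation q x γ) →
      ∃ N : ℕ, ∀ n : ℕ, N ≤ n → (α n : ℕ) = 0)

/-- The asymptotic mean of the `Q_s`-digits of `x` exists and equals `r`. -/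
def HasQsAsymptoticMean {s : ℕ} (q : Fin s → ℝ) (x r : ℝ) : Prop :=
  ∃ α : ℕ → Fin s, IsQsDigits q x α ∧
    Filter.Tendsto (fun n : ℕ => (1 / (n : ℝ)) * ∑ i ∈ Finset.range n, ((α i : ℕ) : ℝ))
      Filter.atTop (nhds r)

/-- The set of all `x ∈ [0, 1]` whose `Q_s`-digits have no asymptotic mean. -/
def qsNoMeanSet {s : ℕ} (q : Fin s → ℝ) : Set ℝ :=
  {x | x ∈ Set.Icc (0 : ℝ) 1 ∧ ¬ ∃ r : ℝ, HasQsAsymptoticMean q x r}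

/-!
Write `value q α` for the number with digit sequence `α`.  Two different sequences of the same value
end in zeros and in the last digit, respectively (`tails_of_value_eq`), so their averages converge;
hence `value q α` lies in `qsNoMeanSet q` exactly when the averages of `α` diverge, whichever
representation `α` is taken (`value_mem_qsNoMeanSet_iff`).  All five claims then concern averages of
digit sequences.

*Measure zero.*  Deleting the first digit is a piecewise affine map of `[0, 1)` that preserves
Lebesgue measure, and the shifted point is independent of the deleted digit.  The digits are thus
identically distributed and pairwise independent, and the strong law of large numbers applies.
In particular `qsNoMeanSet q` contains no interval.

*Dimension and cardinality.*  Let `c` be a digit sequence whose averages diverge.  Insert into an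
arbitrary sequence `ω`, after every `K` digits, the digits of `c`, or else zeros.  The averages of the
two results cannot both converge, since their difference would yield an average of `c`
(`hasAverage_of_hasAverage_insertDigits`).  So one of the two insertions leads into `qsNoMeanSet q`,
for every `ω`.  Undoing an insertion is a Hölder map whose exponent tends to `1` as `K` grows
(`abs_value_sub_pow_le`): the inserted digits cost only a small power of the length of an interval,
and a common inserted digit keeps points of neighbouring intervals apart (`separation`).  Therefore
`[0, 1]` is covered by two images of subsets of `qsNoMeanSet q` under such maps
(`exists_holder_cover`), which bounds both the dimension and the cardinality from below, without
constructing a measure on `qsNoMeanSet q`.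

*Density.*  Prepending digits does not affect the divergence of averages.
-/

namespace QsExpansion

open Filter Topology

variable {s : ℕ} {q : Fin s → ℝ}

/-! ### The intervals of rank one -/

theorem qsBeta_nonneg (hq : ∀ i, 0 < q i) (j : Fin s) : 0 ≤ qsBeta q j :=
  Finset.sum_nonneg fun i _ => (hq i).le

theorem qsBeta_add_self (q : Fin s → ℝ) (j : Fin s) :
    qsBeta q j + q j = ∑ i ∈ Finset.Iic j, q i := by
  rw [qsBeta, ← Finset.Iio_insert, Finset.sum_insert (by simp), add_comm]

theorem qsBeta_add_self_le_one (hq : ∀ i, 0 < q i) (hsum : ∑ i, q i = 1) (j : Fin s) :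
    qsBeta q j + q j ≤ 1 := by
  rw [qsBeta_add_self, ← hsum]
  exact Finset.sum_le_sum_of_subset_of_nonneg (Finset.subset_univ _) fun i _ _ => (hq i).le

theorem qsBeta_add_self_le_of_lt (hq : ∀ i, 0 < q i) {i j : Fin s} (h : i < j) :
    qsBeta q i + q i ≤ qsBeta q j := by
  rw [qsBeta_add_self]
  refine Finset.sum_le_sum_of_subset_of_nonneg (fun k hk => ?_) fun i _ _ => (hq i).le
  simp only [Finset.mem_Iic, Finset.mem_Iio] at hk ⊢
  exact hk.trans_lt h

theorem qsBeta_eq_zero {j : Fin s} (hj : (j : ℕ) = 0) : qsBeta q j = 0 := by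
  refine Finset.sum_eq_zero fun i hi => ?_
  simp only [Finset.mem_Iio, Fin.lt_def] at hi
  omega

theorem qsBeta_add_self_eq_one (hsum : ∑ i, q i = 1) {j : Fin s} (hj : (j : ℕ) + 1 = s) :
    qsBeta q j + q j = 1 := by
  rw [qsBeta_add_self, ← hsum]
  congr 1
  ext i
  simp only [Finset.mem_Iic, Finset.mem_univ, iff_true, Fin.le_def]
  omega

/-- The intervals `[β_j, β_j + q_j)` cover `[0, 1)`. -/
theorem exists_mem_Ico_qsBeta (hsum : ∑ i, q i = 1) {x : ℝ}
    (hx : x ∈ Set.Ico (0 : ℝ) 1) : ∃ j, x ∈ Set.Ico (qsBeta q j) (qsBeta q j + q j) := by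
  have hs : 0 < s := by
    rcases Nat.eq_zero_or_pos s with rfl | h
    · simp at hsum
    · exact h
  classical
  -- the wanted index is the largest `j` with `β_j ≤ x`
  let F : Finset (Fin s) := Finset.univ.filter fun j => qsBeta q j ≤ x
  have hF : F.Nonempty := ⟨⟨0, hs⟩, by simp [F, qsBeta_eq_zero, hx.1]⟩
  have hmem : qsBeta q (F.max' hF) ≤ x := (Finset.mem_filter.1 (F.max'_mem hF)).2
  refine ⟨F.max' hF, hmem, ?_⟩
  by_contra! hlt
  by_cases hj : (F.max' hF : ℕ) + 1 = s
  · exact absurd hx.2 (by rw [← qsBeta_add_self_eq_one hsum hj]; exact not_lt.2 hlt)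
  · have hlt' : (F.max' hF : ℕ) + 1 < s := by have := (F.max' hF).2; omega
    let j' : Fin s := ⟨(F.max' hF : ℕ) + 1, hlt'⟩
    have hIio : qsBeta q j' = qsBeta q (F.max' hF) + q (F.max' hF) := by
      rw [qsBeta_add_self, qsBeta]
      congr 1
      ext i
      simp only [Finset.mem_Iic, Finset.mem_Iio, Fin.le_def, Fin.lt_def, j']
      omega
    have : j' ≤ F.max' hF := F.le_max' _ (by simp [F, hIio, hlt])
    simp only [Fin.le_def, j'] at this
    omega

/-- The probabilities `q i` are bounded away from `0` and from `1` by the same constant. -/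
theorem exists_bounds (hs : 2 ≤ s) (hq : ∀ i, 0 < q i) (hsum : ∑ i, q i = 1) :
    ∃ ρ : ℝ, 0 < ρ ∧ ρ < 1 ∧ ∀ i, ρ ≤ q i ∧ q i ≤ 1 - ρ := by
  have : Nonempty (Fin s) := ⟨⟨0, by omega⟩⟩
  obtain ⟨m, hm⟩ := Finite.exists_min q
  have hle : ∀ i, q i ≤ 1 - q m := by
    intro i
    obtain ⟨j, hj⟩ : ∃ j : Fin s, j ≠ i := by
      have : Nontrivial (Fin s) := Fin.nontrivial_iff_two_le.2 hs
      exact exists_ne i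
    have h := Finset.sum_le_sum_of_subset_of_nonneg (Finset.subset_univ {i, j})
      (fun k _ _ => (hq k).le : ∀ k ∈ Finset.univ, k ∉ ({i, j} : Finset (Fin s)) → 0 ≤ q k)
    rw [Finset.sum_pair hj.symm, hsum] at h
    linarith [hm j]
  exact ⟨q m, hq m, by linarith [hle m, hq m], fun i => ⟨hm i, hle i⟩⟩

/-! ### The value of a digit sequence -/

/-- The length `q_{α_1} ⋯ q_{α_n}` of the interval of rank `n` containing the point with
digits `α`. -/
noncomputable def cylLength (q : Fin s → ℝ) (α : ℕ → Fin s) (n : ℕ) : ℝ :=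
  ∏ j ∈ Finset.range n, q (α j)

/-- The number represented by the digit sequence `α`. -/
noncomputable def value (q : Fin s → ℝ) (α : ℕ → Fin s) : ℝ :=
  ∑' k : ℕ, qsBeta q (α k) * ∏ j ∈ Finset.range k, q (α j)

theorem cylLength_zero (α : ℕ → Fin s) : cylLength q α 0 = 1 := by simp [cylLength]

theorem cylLength_succ (α : ℕ → Fin s) (n : ℕ) :
    cylLength q α (n + 1) = cylLength q α n * q (α n) := Finset.prod_range_succ _ _

theorem cylLength_succ' (α : ℕ → Fin s) (n : ℕ) :
    cylLength q α (n + 1) = q (α 0) * cylLength q (fun k => α (k + 1)) n := by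
  rw [cylLength, Finset.prod_range_succ', mul_comm]; rfl

theorem cylLength_pos (hq : ∀ i, 0 < q i) (α : ℕ → Fin s) (n : ℕ) : 0 < cylLength q α n :=
  Finset.prod_pos fun _ _ => hq _

theorem sum_add_cylLength_le_one (hq : ∀ i, 0 < q i) (hsum : ∑ i, q i = 1) (α : ℕ → Fin s)
    (n : ℕ) : ∑ k ∈ Finset.range n, qsBeta q (α k) * cylLength q α k + cylLength q α n ≤ 1 := by
  induction n with
  | zero => simp [cylLength_zero]
  | succ n ih =>
    rw [Finset.sum_range_succ, cylLength_succ]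
    nlinarith [cylLength_pos hq α n, qsBeta_add_self_le_one hq hsum (α n)]

theorem summable_value (hq : ∀ i, 0 < q i) (hsum : ∑ i, q i = 1) (α : ℕ → Fin s) :
    Summable fun k : ℕ => qsBeta q (α k) * ∏ j ∈ Finset.range k, q (α j) := by
  refine summable_of_sum_range_le (c := 1)
    (fun n => mul_nonneg (qsBeta_nonneg hq _) (cylLength_pos hq α n).le) fun n => ?_
  have := sum_add_cylLength_le_one hq hsum α n
  have := cylLength_pos hq α n
  simp only [cylLength] at *
  linarith

theorem isQsRepresentation_iff (hq : ∀ i, 0 < q i) (hsum : ∑ i, q i = 1) {x : ℝ}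
    {α : ℕ → Fin s} : IsQsRepresentation q x α ↔ value q α = x :=
  (summable_value hq hsum α).hasSum_iff

theorem value_nonneg (hq : ∀ i, 0 < q i) (α : ℕ → Fin s) : 0 ≤ value q α :=
  tsum_nonneg fun n => mul_nonneg (qsBeta_nonneg hq _) (cylLength_pos hq α n).le

theorem value_le_one (hq : ∀ i, 0 < q i) (hsum : ∑ i, q i = 1) (α : ℕ → Fin s) :
    value q α ≤ 1 := by
  refine Real.tsum_le_of_sum_range_le
    (fun n => mul_nonneg (qsBeta_nonneg hq _) (cylLength_pos hq α n).le) fun n => ?_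
  have := sum_add_cylLength_le_one hq hsum α n
  have := cylLength_pos hq α n
  simp only [cylLength] at *
  linarith

theorem value_eq (hq : ∀ i, 0 < q i) (hsum : ∑ i, q i = 1) (α : ℕ → Fin s) :
    value q α = qsBeta q (α 0) + q (α 0) * value q fun k => α (k + 1) := by
  rw [value, (summable_value hq hsum α).tsum_eq_zero_add, value, ← tsum_mul_left]
  simp only [Finset.prod_range_zero, mul_one, Finset.prod_range_succ']
  congr 1
  refine tsum_congr fun k => ?_
  ring

/-- Two sequences with the same first `n` digits differ in value by the length of the common
interval of rank `n` times the difference of the values of their tails. -/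
theorem value_sub_value_of_agree (hq : ∀ i, 0 < q i) (hsum : ∑ i, q i = 1) (n : ℕ)
    (α γ : ℕ → Fin s) (h : ∀ k < n, α k = γ k) :
    value q γ - value q α =
      cylLength q α n * (value q (fun k => γ (k + n)) - value q fun k => α (k + n)) := by
  induction n generalizing α γ with
  | zero => simp [cylLength_zero]
  | succ n ih =>
    rw [value_eq hq hsum α, value_eq hq hsum γ, ← h 0 (by omega), cylLength_succ']
    have := ih (fun k => α (k + 1)) (fun k => γ (k + 1)) fun k hk => h _ (by omega)
    beta_reduce at this
    simp only [← add_assoc]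
    rw [mul_assoc, ← this]
    ring

theorem abs_value_sub_value_le (hq : ∀ i, 0 < q i) (hsum : ∑ i, q i = 1) (n : ℕ)
    (α γ : ℕ → Fin s) (h : ∀ k < n, α k = γ k) :
    |value q γ - value q α| ≤ cylLength q α n := by
  rw [value_sub_value_of_agree hq hsum n α γ h, abs_mul, abs_of_pos (cylLength_pos hq α n)]
  refine mul_le_of_le_one_right (cylLength_pos hq α n).le ?_
  rw [abs_le]
  constructor <;> linarith [value_nonneg hq (fun k => γ (k + n)),
    value_nonneg hq (fun k => α (k + n)), value_le_one hq hsum (fun k => γ (k + n)),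
    value_le_one hq hsum (fun k => α (k + n))]

/-- A single nonzero digit keeps the value away from `0`. -/
theorem pow_le_value (hq : ∀ i, 0 < q i) (hsum : ∑ i, q i = 1) {ρ : ℝ} (hρ : 0 < ρ)
    (hρq : ∀ i, ρ ≤ q i) (i : ℕ) (α : ℕ → Fin s) (h : (α i : ℕ) ≠ 0) :
    ρ ^ (i + 1) ≤ value q α := by
  induction i generalizing α with
  | zero =>
    rw [value_eq hq hsum]
    have h0 : (⟨0, (α 0).pos⟩ : Fin s) < α 0 := by
      rw [Fin.lt_def]; exact Nat.pos_of_ne_zero h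
    have h1 := qsBeta_add_self_le_of_lt hq h0
    have h2 := mul_nonneg (hq (α 0)).le (value_nonneg hq fun k => α (k + 1))
    have := hρq ⟨0, (α 0).pos⟩
    have := qsBeta_nonneg hq ⟨0, (α 0).pos⟩
    simp only [zero_add, pow_one]
    linarith
  | succ i ih =>
    rw [value_eq hq hsum, pow_succ']
    have := ih (fun k => α (k + 1)) h
    have := mul_le_mul (hρq (α 0)) this (by positivity) (hq _).le
    linarith [qsBeta_nonneg hq (α 0)]

/-- A single digit other than the last one keeps the value away from `1`. -/
theorem pow_le_one_sub_value (hq : ∀ i, 0 < q i) (hsum : ∑ i, q i = 1) {ρ : ℝ} (hρ : 0 < ρ)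
    (hρq : ∀ i, ρ ≤ q i) (i : ℕ) (α : ℕ → Fin s) (h : (α i : ℕ) + 1 ≠ s) :
    ρ ^ (i + 1) ≤ 1 - value q α := by
  induction i generalizing α with
  | zero =>
    rw [value_eq hq hsum]
    let j : Fin s := ⟨α 0 + 1, by have := (α 0).2; omega⟩
    have h0 : α 0 < j := by simp [Fin.lt_def, j]
    have h1 := qsBeta_add_self_le_of_lt hq h0
    have h2 := mul_le_of_le_one_right (hq (α 0)).le
      (value_le_one hq hsum fun k => α (k + 1))
    have := hρq j
    have := qsBeta_add_self_le_one hq hsum j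
    simp only [zero_add, pow_one]
    linarith
  | succ i ih =>
    rw [value_eq hq hsum, pow_succ']
    have := ih (fun k => α (k + 1)) h
    have := mul_le_mul (hρq (α 0)) this (by positivity) (hq _).le
    linarith [qsBeta_add_self_le_one hq hsum (α 0)]

/-- The gap between two points whose first digits differ is bounded below by what the left point
leaves to the right of it, and the right point to the left of it, in their intervals of
rank one. -/
theorem gap_le_value_sub_value (hq : ∀ i, 0 < q i) (hsum : ∑ i, q i = 1) {ρ : ℝ}
    (hρq : ∀ i, ρ ≤ q i) {α γ : ℕ → Fin s} (h : α 0 < γ 0) :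
    ρ * (value q (fun k => γ (k + 1)) + (1 - value q fun k => α (k + 1))) ≤
      value q γ - value q α := by
  rw [value_eq hq hsum α, value_eq hq hsum γ]
  have h1 := qsBeta_add_self_le_of_lt hq h
  have h2 := mul_le_mul_of_nonneg_right (hρq (γ 0)) (value_nonneg hq fun k => γ (k + 1))
  have h3 := mul_le_mul_of_nonneg_right (hρq (α 0))
    (sub_nonneg.2 (value_le_one hq hsum fun k => α (k + 1)))
  linarith

/-- If two digit sequences part at place `n` and meet again in a digit at a later place, then
their values are separated by a fixed portion of the common interval of rank `n`: this digit
cannot be both the first and the last one, so that the points stay away from the common endpoint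
of their intervals. -/
theorem separation (hs : 2 ≤ s) (hq : ∀ i, 0 < q i) (hsum : ∑ i, q i = 1) {ρ : ℝ} (hρ : 0 < ρ)
    (hρq : ∀ i, ρ ≤ q i) {α γ : ℕ → Fin s} {n i : ℕ} (hagree : ∀ k < n, α k = γ k)
    (hne : α n ≠ γ n) (hi : α (n + 1 + i) = γ (n + 1 + i)) :
    ρ ^ (i + 2) * cylLength q α n ≤ |value q γ - value q α| := by
  wlog hlt : α n < γ n generalizing α γ
  · have hgt : γ n < α n := lt_of_le_of_ne (not_lt.1 hlt) hne.symm
    have := this (fun k hk => (hagree k hk).symm) hne.symm hi.symm hgt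
    rw [abs_sub_comm]
    convert this using 2
    exact Finset.prod_congr rfl fun k hk => by rw [hagree k (Finset.mem_range.1 hk)]
  rw [value_sub_value_of_agree hq hsum n α γ hagree, abs_mul,
    abs_of_pos (cylLength_pos hq α n), mul_comm]
  refine mul_le_mul_of_nonneg_left (le_trans ?_ (le_abs_self _)) (cylLength_pos hq α n).le
  refine le_trans ?_ (gap_le_value_sub_value hq hsum hρq
    (α := fun k => α (k + n)) (γ := fun k => γ (k + n)) (by simpa using hlt))
  rw [show i + 2 = (i + 1) + 1 from rfl, pow_succ']
  refine mul_le_mul_of_nonneg_left ?_ hρ.le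
  have hidx : i + 1 + n = n + 1 + i := by omega
  by_cases h0 : (γ (n + 1 + i) : ℕ) = 0
  · have := pow_le_one_sub_value hq hsum hρ hρq i (fun k => α (k + 1 + n))
      (by simp only [hidx, hi]; omega)
    linarith [value_nonneg hq fun k => γ (k + 1 + n)]
  · have := pow_le_value hq hsum hρ hρq i (fun k => γ (k + 1 + n)) (by simpa only [hidx] using h0)
    linarith [value_le_one hq hsum fun k => α (k + 1 + n)]

/-- Two sequences of the same value whose digits part at place `n` end in zeros and in the last
digit, respectively. -/
theorem tails_of_value_eq (hq : ∀ i, 0 < q i) (hsum : ∑ i, q i = 1) {ρ : ℝ} (hρ : 0 < ρ)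
    (hρq : ∀ i, ρ ≤ q i) {α γ : ℕ → Fin s} (hv : value q α = value q γ) {n : ℕ}
    (hagree : ∀ k < n, α k = γ k) (hlt : α n < γ n) :
    ∀ k, (γ (k + 1 + n) : ℕ) = 0 ∧ (α (k + 1 + n) : ℕ) + 1 = s := by
  have h := value_sub_value_of_agree hq hsum n α γ hagree
  rw [hv, sub_self, zero_eq_mul, or_iff_right (cylLength_pos hq α n).ne'] at h
  have hgap := gap_le_value_sub_value hq hsum hρq
    (α := fun k => α (k + n)) (γ := fun k => γ (k + n)) (by simpa using hlt)
  rw [h] at hgap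
  have hle := nonpos_of_mul_nonpos_right hgap hρ
  have h1 := value_nonneg hq fun k => γ (k + 1 + n)
  have h2 := value_le_one hq hsum fun k => α (k + 1 + n)
  intro k
  have hk : 0 < ρ ^ (k + 1) := by positivity
  constructor
  · by_contra h0
    have := pow_le_value hq hsum hρ hρq k (fun k => γ (k + 1 + n)) h0
    linarith
  · by_contra h0
    have := pow_le_one_sub_value hq hsum hρ hρq k (fun k => α (k + 1 + n)) h0
    linarith

/-! ### Averages of digits -/

/-- The mean of the first `n` digits. -/
noncomputable def digitAverage (α : ℕ → Fin s) (n : ℕ) : ℝ :=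
  (1 / (n : ℝ)) * ∑ i ∈ Finset.range n, ((α i : ℕ) : ℝ)

/-- The sequence of digits has an asymptotic mean. -/
def HasAverage (α : ℕ → Fin s) : Prop := ∃ r, Tendsto (digitAverage α) atTop (𝓝 r)

theorem tendsto_digitAverage_of_eventually_eq {α : ℕ → Fin s} {d N : ℕ}
    (h : ∀ n, N ≤ n → (α n : ℕ) = d) : Tendsto (digitAverage α) atTop (𝓝 d) := by
  have h1 : Tendsto (fun n => ((α n : ℕ) : ℝ)) atTop (𝓝 d) := by
    refine tendsto_const_nhds.congr' ?_
    filter_upwards [eventually_ge_atTop N] with n hn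
    rw [h n hn]
  refine h1.cesaro.congr fun n => ?_
  rw [digitAverage, one_div]

theorem HasAverage.tail {α : ℕ → Fin s} (h : HasAverage α) :
    HasAverage fun k => α (k + 1) := by
  obtain ⟨r, hr⟩ := h
  refine ⟨r, ?_⟩
  have h1 : Tendsto (fun n : ℕ => ((n : ℝ) + 1) / n) atTop (𝓝 1) := by
    have : Tendsto (fun n : ℕ => 1 + 1 / (n : ℝ)) atTop (𝓝 (1 + 0)) :=
      tendsto_const_nhds.add tendsto_one_div_atTop_nhds_zero_nat
    rw [add_zero] at this
    refine this.congr' ?_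
    filter_upwards [eventually_gt_atTop 0] with n hn
    have : (n : ℝ) ≠ 0 := by positivity
    field_simp
  have h2 : Tendsto (fun n : ℕ => ((α 0 : ℕ) : ℝ) * (1 / (n : ℝ))) atTop (𝓝 (_ * 0)) :=
    tendsto_const_nhds.mul tendsto_one_div_atTop_nhds_zero_nat
  have h3 := (h1.mul (hr.comp (tendsto_add_atTop_nat 1))).sub h2
  rw [mul_zero, sub_zero, one_mul] at h3
  refine h3.congr' ?_
  filter_upwards [eventually_gt_atTop 0] with n hn
  have : (n : ℝ) ≠ 0 := by positivity
  have : (n : ℝ) + 1 ≠ 0 := by positivity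
  simp only [digitAverage, Function.comp, Finset.sum_range_succ']
  push_cast
  field_simp
  ring

/-- A sequence without asymptotic mean is the only representation of its value, because it does
not end in a constant digit. -/
theorem eq_of_value_eq (hs : 2 ≤ s) (hq : ∀ i, 0 < q i) (hsum : ∑ i, q i = 1)
    {α γ : ℕ → Fin s} (hα : ¬ HasAverage α) (hv : value q α = value q γ) : α = γ := by
  obtain ⟨ρ, hρ, -, hρq⟩ := exists_bounds hs hq hsum
  by_contra hne
  have hex : ∃ n, α n ≠ γ n := Function.ne_iff.1 hne
  classical
  have hagree : ∀ k < Nat.find hex, α k = γ k := fun k hk => not_not.1 (Nat.find_min hex hk)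
  rcases lt_or_gt_of_ne (Nat.find_spec hex) with hlt | hlt
  · have h := tails_of_value_eq hq hsum hρ (fun i => (hρq i).1) hv hagree hlt
    refine hα ⟨_, tendsto_digitAverage_of_eventually_eq (d := s - 1)
      (N := Nat.find hex + 1) fun n hn => ?_⟩
    have := (h (n - (Nat.find hex + 1))).2
    rw [show n - (Nat.find hex + 1) + 1 + Nat.find hex = n by omega] at this
    omega
  · have h := tails_of_value_eq hq hsum hρ (fun i => (hρq i).1) hv.symm
      (fun k hk => (hagree k hk).symm) hlt
    refine hα ⟨_, tendsto_digitAverage_of_eventually_eq (d := 0)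
      (N := Nat.find hex + 1) fun n hn => ?_⟩
    have := (h (n - (Nat.find hex + 1))).1
    rwa [show n - (Nat.find hex + 1) + 1 + Nat.find hex = n by omega] at this

/-- Of two different sequences with the same value one ends in zeros. -/
theorem eventually_zero_of_value_eq (hs : 2 ≤ s) (hq : ∀ i, 0 < q i) (hsum : ∑ i, q i = 1)
    {α γ : ℕ → Fin s} (hne : γ ≠ α) (hv : value q γ = value q α) :
    (∃ N, ∀ n, N ≤ n → (α n : ℕ) = 0) ∨ ∃ N, ∀ n, N ≤ n → (γ n : ℕ) = 0 := by
  obtain ⟨ρ, hρ, -, hρq⟩ := exists_bounds hs hq hsum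
  have hex : ∃ n, γ n ≠ α n := Function.ne_iff.1 hne
  classical
  have hagree : ∀ k < Nat.find hex, γ k = α k := fun k hk => not_not.1 (Nat.find_min hex hk)
  rcases lt_or_gt_of_ne (Nat.find_spec hex) with hlt | hlt
  · left
    refine ⟨Nat.find hex + 1, fun n hn => ?_⟩
    have := (tails_of_value_eq hq hsum hρ (fun i => (hρq i).1) hv hagree hlt
      (n - (Nat.find hex + 1))).1
    rwa [show n - (Nat.find hex + 1) + 1 + Nat.find hex = n by omega] at this
  · right
    refine ⟨Nat.find hex + 1, fun n hn => ?_⟩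
    have := (tails_of_value_eq hq hsum hρ (fun i => (hρq i).1) hv.symm
      (fun k hk => (hagree k hk).symm) hlt (n - (Nat.find hex + 1))).1
    rwa [show n - (Nat.find hex + 1) + 1 + Nat.find hex = n by omega] at this

/-- Membership in `qsNoMeanSet` can be tested on any representation: the rule that selects the
digits of a number with two representations plays no role, because both of these end in a
constant digit. -/
theorem value_mem_qsNoMeanSet_iff (hs : 2 ≤ s) (hq : ∀ i, 0 < q i) (hsum : ∑ i, q i = 1)
    {α : ℕ → Fin s} : value q α ∈ qsNoMeanSet q ↔ ¬ HasAverage α := by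
  constructor
  · rintro ⟨-, hno⟩ ⟨r, hr⟩
    by_cases hdig : IsQsDigits q (value q α) α
    · exact hno ⟨r, α, hdig, hr⟩
    · have hrep : IsQsRepresentation q (value q α) α := (isQsRepresentation_iff hq hsum).2 rfl
      simp only [IsQsDigits, not_and, Classical.not_imp] at hdig
      obtain ⟨⟨γ, hne, hγ⟩, hz⟩ := hdig hrep
      obtain ⟨N, hN⟩ := (eventually_zero_of_value_eq hs hq hsum hne
        ((isQsRepresentation_iff hq hsum).1 hγ)).resolve_left hz
      exact hno ⟨_, γ, ⟨hγ, fun _ => ⟨N, hN⟩⟩, tendsto_digitAverage_of_eventually_eq hN⟩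
  · intro hα
    refine ⟨⟨value_nonneg hq α, value_le_one hq hsum α⟩, ?_⟩
    rintro ⟨r, γ, ⟨hγ, -⟩, hr⟩
    obtain rfl := eq_of_value_eq hs hq hsum hα ((isQsRepresentation_iff hq hsum).1 hγ).symm
    exact hα ⟨r, hr⟩

/-! ### The digit map and Lebesgue measure -/

open Classical in
/-- The first digit of `x ∈ [0, 1]`: the index of the interval `[β_j, β_j + q_j)` that contains
`x`. The point `1`, which lies in none of them, gets the last digit; so do all points
outside `[0, 1]`. -/
noncomputable def firstDigit (hs : 2 ≤ s) (q : Fin s → ℝ) (x : ℝ) : Fin s :=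
  if h : ∃ j, x ∈ Set.Ico (qsBeta q j) (qsBeta q j + q j) then h.choose else ⟨s - 1, by omega⟩

/-- The map that deletes the first digit. -/
noncomputable def digitShift (hs : 2 ≤ s) (q : Fin s → ℝ) (x : ℝ) : ℝ :=
  (x - qsBeta q (firstDigit hs q x)) / q (firstDigit hs q x)

/-- The digits of `x`, read off along the orbit of `x` under `digitShift`. -/
noncomputable def digits (hs : 2 ≤ s) (q : Fin s → ℝ) (x : ℝ) (k : ℕ) : Fin s :=
  firstDigit hs q ((digitShift hs q)^[k] x)

theorem firstDigit_eq (hs : 2 ≤ s) (hq : ∀ i, 0 < q i) {x : ℝ} {j : Fin s}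
    (hx : x ∈ Set.Ico (qsBeta q j) (qsBeta q j + q j)) : firstDigit hs q x = j := by
  have h : ∃ j, x ∈ Set.Ico (qsBeta q j) (qsBeta q j + q j) := ⟨j, hx⟩
  rw [firstDigit, dif_pos h]
  have hc := h.choose_spec
  rcases lt_trichotomy h.choose j with hlt | heq | hlt
  · linarith [qsBeta_add_self_le_of_lt hq hlt, hx.1, hc.2]
  · exact heq
  · linarith [qsBeta_add_self_le_of_lt hq hlt, hx.2, hc.1]

theorem firstDigit_eq_iff (hs : 2 ≤ s) (hq : ∀ i, 0 < q i) (hsum : ∑ i, q i = 1) {x : ℝ}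
    (hx : x ∈ Set.Ico (0 : ℝ) 1) {j : Fin s} :
    firstDigit hs q x = j ↔ x ∈ Set.Ico (qsBeta q j) (qsBeta q j + q j) := by
  refine ⟨fun h => ?_, firstDigit_eq hs hq⟩
  obtain ⟨i, hi⟩ := exists_mem_Ico_qsBeta hsum hx
  rwa [← h, firstDigit_eq hs hq hi]

theorem mem_Icc_firstDigit (hs : 2 ≤ s) (hq : ∀ i, 0 < q i) (hsum : ∑ i, q i = 1) {x : ℝ}
    (hx : x ∈ Set.Icc (0 : ℝ) 1) :
    x ∈ Set.Icc (qsBeta q (firstDigit hs q x))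
      (qsBeta q (firstDigit hs q x) + q (firstDigit hs q x)) := by
  by_cases h : ∃ j, x ∈ Set.Ico (qsBeta q j) (qsBeta q j + q j)
  · obtain ⟨j, hj⟩ := h
    rw [firstDigit_eq hs hq hj]
    exact Set.Ico_subset_Icc_self hj
  · have hx1 : x = 1 := by
      by_contra hne
      exact h (exists_mem_Ico_qsBeta hsum ⟨hx.1, lt_of_le_of_ne hx.2 hne⟩)
    rw [firstDigit, dif_neg h, hx1]
    have h1 := qsBeta_add_self_eq_one hsum (j := (⟨s - 1, by omega⟩ : Fin s))
      (by simp only; omega)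
    exact ⟨by linarith [hq ⟨s - 1, by omega⟩], h1.ge⟩

theorem qsBeta_add_mul_digitShift (hs : 2 ≤ s) (hq : ∀ i, 0 < q i) (x : ℝ) :
    qsBeta q (firstDigit hs q x) + q (firstDigit hs q x) * digitShift hs q x = x := by
  rw [digitShift, mul_div_cancel₀ _ (hq _).ne']
  ring

theorem digitShift_mem_Icc (hs : 2 ≤ s) (hq : ∀ i, 0 < q i) (hsum : ∑ i, q i = 1) {x : ℝ}
    (hx : x ∈ Set.Icc (0 : ℝ) 1) : digitShift hs q x ∈ Set.Icc (0 : ℝ) 1 := by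
  have h := mem_Icc_firstDigit hs hq hsum hx
  refine ⟨div_nonneg (by linarith [h.1]) (hq _).le, ?_⟩
  rw [digitShift, div_le_one (hq _)]
  linarith [h.2]

theorem value_digits (hs : 2 ≤ s) (hq : ∀ i, 0 < q i) (hsum : ∑ i, q i = 1) {x : ℝ}
    (hx : x ∈ Set.Icc (0 : ℝ) 1) : value q (digits hs q x) = x := by
  obtain ⟨ρ, hρ, hρ1, hρq⟩ := exists_bounds hs hq hsum
  -- `x` and the value of its digits satisfy the same recursion, which contracts their difference
  have key : ∀ n : ℕ, ∀ x ∈ Set.Icc (0 : ℝ) 1,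
      |value q (digits hs q x) - x| ≤ (1 - ρ) ^ n := by
    intro n
    induction n with
    | zero =>
      intro x hx
      rw [pow_zero, abs_le]
      constructor <;> linarith [hx.1, hx.2, value_nonneg hq (digits hs q x),
        value_le_one hq hsum (digits hs q x)]
    | succ n ih =>
      intro x hx
      have h1 : value q (digits hs q x) - x = q (firstDigit hs q x) *
          (value q (digits hs q (digitShift hs q x)) - digitShift hs q x) := by
        have h2 : value q (digits hs q x) = qsBeta q (firstDigit hs q x) +
            q (firstDigit hs q x) * value q (digits hs q (digitShift hs q x)) :=
          value_eq hq hsum (digits hs q x)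
        linarith [qsBeta_add_mul_digitShift hs hq x]
      rw [h1, abs_mul, abs_of_pos (hq _), pow_succ']
      exact mul_le_mul (hρq _).2 (ih _ (digitShift_mem_Icc hs hq hsum hx)) (abs_nonneg _)
        (by linarith)
  have h0 : Tendsto (fun n : ℕ => (1 - ρ) ^ n) atTop (𝓝 0) :=
    tendsto_pow_atTop_nhds_zero_of_lt_one (by linarith) (by linarith)
  have := ge_of_tendsto' h0 fun n => key n x hx
  exact sub_eq_zero.1 (abs_nonpos_iff.1 this)

theorem mem_qsNoMeanSet_iff (hs : 2 ≤ s) (hq : ∀ i, 0 < q i) (hsum : ∑ i, q i = 1) {x : ℝ}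
    (hx : x ∈ Set.Icc (0 : ℝ) 1) : x ∈ qsNoMeanSet q ↔ ¬ HasAverage (digits hs q x) := by
  rw [← value_mem_qsNoMeanSet_iff hs hq hsum, value_digits hs hq hsum hx]

open MeasureTheory ProbabilityTheory

theorem measurable_firstDigit (hs : 2 ≤ s) (hq : ∀ i, 0 < q i) :
    Measurable (firstDigit hs q) := by
  refine measurable_to_countable' fun j => ?_
  let J : Fin s → Set ℝ := fun j => Set.Ico (qsBeta q j) (qsBeta q j + q j)
  have hJ : ∀ j, MeasurableSet (J j) := fun j => measurableSet_Ico
  have : firstDigit hs q ⁻¹' {j} =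
      J j ∪ ((⋃ i, J i)ᶜ ∩ {_x | (⟨s - 1, by omega⟩ : Fin s) = j}) := by
    ext x
    simp only [Set.mem_preimage, Set.mem_singleton_iff, Set.mem_union, Set.mem_inter_iff,
      Set.mem_compl_iff, Set.mem_iUnion, Set.mem_ofPred_eq]
    by_cases h : ∃ i, x ∈ J i
    · simp only [h, not_true_eq_false, false_and, or_false]
      obtain ⟨i, hi⟩ := h
      refine ⟨fun hx => ?_, firstDigit_eq hs hq⟩
      rwa [← hx, firstDigit_eq hs hq hi]
    · rw [firstDigit, dif_neg h]
      simp only [h, not_false_eq_true, true_and]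
      exact ⟨Or.inr, fun h' => h'.resolve_left fun hx => h ⟨j, hx⟩⟩
  rw [this]
  exact (hJ j).union ((MeasurableSet.iUnion hJ).compl.inter (MeasurableSet.const _))

theorem measurable_digitShift (hs : 2 ≤ s) (hq : ∀ i, 0 < q i) :
    Measurable (digitShift hs q) :=
  (measurable_id.sub ((measurable_of_countable (qsBeta q)).comp (measurable_firstDigit hs hq))).div
    ((measurable_of_countable q).comp (measurable_firstDigit hs hq))

/-- Lebesgue measure on the half-open unit interval. -/
noncomputable abbrev unitVolume : Measure ℝ := volume.restrict (Set.Ico (0 : ℝ) 1)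

/-- On the interval of rank one with digit `j` the map `digitShift` is the affine bijection onto
`[0, 1)`, so under Lebesgue measure the first digit is independent of the shifted point. -/
theorem unitVolume_firstDigit_inter (hs : 2 ≤ s) (hq : ∀ i, 0 < q i) (hsum : ∑ i, q i = 1)
    (j : Fin s) (A : Set ℝ) :
    unitVolume (firstDigit hs q ⁻¹' {j} ∩ digitShift hs q ⁻¹' A) =
      ENNReal.ofReal (q j) * unitVolume A := by
  rw [Measure.restrict_apply' measurableSet_Ico, Measure.restrict_apply' measurableSet_Ico]
  have hset : firstDigit hs q ⁻¹' {j} ∩ digitShift hs q ⁻¹' A ∩ Set.Ico 0 1 =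
      (fun x => x + -qsBeta q j) ⁻¹' ((fun x => (q j)⁻¹ * x) ⁻¹' (A ∩ Set.Ico 0 1)) := by
    have hqj := hq j
    have haff : ∀ x : ℝ, (q j)⁻¹ * (x + -qsBeta q j) = (x - qsBeta q j) / q j := fun x => by
      rw [← sub_eq_add_neg, div_eq_inv_mul]
    have hico : ∀ x : ℝ, (x - qsBeta q j) / q j ∈ Set.Ico (0 : ℝ) 1 ↔
        x ∈ Set.Ico (qsBeta q j) (qsBeta q j + q j) := fun x => by
      rw [Set.mem_Ico, Set.mem_Ico, div_lt_one hqj, le_div_iff₀ hqj, zero_mul, sub_nonneg,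
        sub_lt_iff_lt_add']
    ext x
    simp only [Set.mem_inter_iff, Set.mem_preimage, Set.mem_singleton_iff, haff, hico]
    constructor
    · rintro ⟨⟨hj, hA⟩, hx⟩
      refine ⟨?_, (firstDigit_eq_iff hs hq hsum hx).1 hj⟩
      rwa [digitShift, hj] at hA
    · rintro ⟨hA, hx⟩
      have hj := firstDigit_eq hs hq hx
      refine ⟨⟨hj, ?_⟩, ?_, ?_⟩
      · rwa [digitShift, hj]
      · exact (qsBeta_nonneg hq j).trans hx.1
      · exact hx.2.trans_le (qsBeta_add_self_le_one hq hsum j)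
  rw [hset, measure_preimage_add_right, Real.volume_preimage_mul_left (inv_ne_zero (hq j).ne'),
    inv_inv, abs_of_pos (hq j)]

theorem measurePreserving_digitShift (hs : 2 ≤ s) (hq : ∀ i, 0 < q i) (hsum : ∑ i, q i = 1) :
    MeasurePreserving (digitShift hs q) unitVolume unitVolume := by
  refine ⟨measurable_digitShift hs hq, Measure.ext fun A hA => ?_⟩
  rw [Measure.map_apply (measurable_digitShift hs hq) hA]
  have hU : digitShift hs q ⁻¹' A =
      ⋃ j : Fin s, firstDigit hs q ⁻¹' {j} ∩ digitShift hs q ⁻¹' A := by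
    ext x; simp
  rw [hU, measure_iUnion, tsum_fintype]
  · simp only [unitVolume_firstDigit_inter hs hq hsum]
    rw [← Finset.sum_mul, ← ENNReal.ofReal_sum_of_nonneg fun i _ => (hq i).le, hsum]
    simp
  · intro i j hij
    refine Set.disjoint_left.2 fun x hx hx' => hij ?_
    exact (Set.mem_singleton_iff.1 hx.1).symm.trans hx'.1
  · exact fun j => ((measurable_firstDigit hs hq) (measurableSet_singleton j)).inter
      ((measurable_digitShift hs hq) hA)

instance : IsProbabilityMeasure unitVolume := ⟨by simp⟩

theorem indepFun_firstDigit_digitShift (hs : 2 ≤ s) (hq : ∀ i, 0 < q i)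
    (hsum : ∑ i, q i = 1) :
    IndepFun (firstDigit hs q) (digitShift hs q) unitVolume := by
  rw [indepFun_iff_measure_inter_preimage_eq_mul]
  intro U A _ hA
  have hmeas : ∀ j, MeasurableSet (firstDigit hs q ⁻¹' {j}) := fun j =>
    (measurable_firstDigit hs hq) (measurableSet_singleton j)
  have hsplit : ∀ B : Set ℝ, MeasurableSet B →
      unitVolume (firstDigit hs q ⁻¹' U ∩ digitShift hs q ⁻¹' B) =
        ∑ j, unitVolume (firstDigit hs q ⁻¹' {j} ∩ digitShift hs q ⁻¹' B) * U.indicator 1 j := by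
    intro B hB
    have hBm := (measurable_digitShift hs hq) hB
    have hU : firstDigit hs q ⁻¹' U ∩ digitShift hs q ⁻¹' B =
        ⋃ j : Fin s, {_x | j ∈ U} ∩ (firstDigit hs q ⁻¹' {j} ∩ digitShift hs q ⁻¹' B) := by
      ext x; simp
    rw [hU, measure_iUnion, tsum_fintype]
    · refine Finset.sum_congr rfl fun j _ => ?_
      by_cases hj : j ∈ U <;> simp [hj]
    · intro i j hij
      refine Set.disjoint_left.2 fun x hx hx' => hij ?_
      exact (Set.mem_singleton_iff.1 hx.2.1).symm.trans hx'.2.1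
    · exact fun j => (MeasurableSet.const _).inter ((hmeas j).inter hBm)
  have h1 := hsplit Set.univ MeasurableSet.univ
  rw [Set.preimage_univ, Set.inter_univ] at h1
  rw [hsplit A hA, h1, Finset.sum_mul,
    (measurePreserving_digitShift hs hq hsum).measure_preimage hA.nullMeasurableSet]
  refine Finset.sum_congr rfl fun j _ => ?_
  rw [unitVolume_firstDigit_inter hs hq hsum, ← Set.preimage_univ (f := digitShift hs q),
    unitVolume_firstDigit_inter hs hq hsum, measure_univ, mul_one, mul_right_comm]

/-- Digits at different places are independent: by invariance under `digitShift` the earlier place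
may be taken to be the first, and the later digit is a function of the shifted point. -/
theorem indepFun_digits (hs : 2 ≤ s) (hq : ∀ i, 0 < q i) (hsum : ∑ i, q i = 1) {i j : ℕ}
    (hij : i < j) :
    IndepFun (fun x => ((digits hs q x i : ℕ) : ℝ)) (fun x => ((digits hs q x j : ℕ) : ℝ))
      unitVolume := by
  obtain ⟨m, rfl⟩ := Nat.exists_eq_add_of_lt hij
  have hT := (measurePreserving_digitShift hs hq hsum).iterate i
  have h0 : IndepFun (fun x => ((digits hs q x 0 : ℕ) : ℝ))
      (fun x => ((digits hs q x (m + 1) : ℕ) : ℝ)) unitVolume :=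
    (indepFun_firstDigit_digitShift hs hq hsum).comp
      (φ := fun d : Fin s => ((d : ℕ) : ℝ)) (ψ := fun y => ((digits hs q y m : ℕ) : ℝ))
      (measurable_of_countable _)
      ((measurable_of_countable fun d : Fin s => ((d : ℕ) : ℝ)).comp
        ((measurable_firstDigit hs hq).comp ((measurable_digitShift hs hq).iterate m)))
  have hshift : ∀ x, digits hs q x (i + m + 1) =
      digits hs q ((digitShift hs q)^[i] x) (m + 1) := fun x => by
    rw [digits, digits, ← Function.iterate_add_apply, add_comm (m + 1) i, add_assoc]
  have hd : ∀ k, Measurable fun x => ((digits hs q x k : ℕ) : ℝ) := fun k =>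
    (measurable_of_countable fun d : Fin s => ((d : ℕ) : ℝ)).comp
      ((measurable_firstDigit hs hq).comp ((measurable_digitShift hs hq).iterate k))
  rw [indepFun_iff_measure_inter_preimage_eq_mul] at h0 ⊢
  intro U V hU hV
  have h := h0 U V hU hV
  have hUm := hd 0 hU
  have hVm := hd (m + 1) hV
  rw [← hT.measure_preimage (hUm.inter hVm).nullMeasurableSet,
    ← hT.measure_preimage hUm.nullMeasurableSet,
    ← hT.measure_preimage hVm.nullMeasurableSet] at h
  simp only [hshift]
  exact h

theorem identDistrib_digits (hs : 2 ≤ s) (hq : ∀ i, 0 < q i) (hsum : ∑ i, q i = 1) (i : ℕ) :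
    IdentDistrib (fun x => ((digits hs q x i : ℕ) : ℝ)) (fun x => ((digits hs q x 0 : ℕ) : ℝ))
      unitVolume unitVolume := by
  have hd : Measurable fun x => ((digits hs q x 0 : ℕ) : ℝ) :=
    (measurable_of_countable fun d : Fin s => ((d : ℕ) : ℝ)).comp (measurable_firstDigit hs hq)
  have hT := (measurePreserving_digitShift hs hq hsum).iterate i
  refine ⟨(hd.comp hT.measurable).aemeasurable, hd.aemeasurable, ?_⟩
  conv_rhs => rw [← hT.map_eq]
  rw [Measure.map_map hd hT.measurable]
  rfl

theorem ae_hasAverage_digits (hs : 2 ≤ s) (hq : ∀ i, 0 < q i) (hsum : ∑ i, q i = 1) :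
    ∀ᵐ x ∂unitVolume, HasAverage (digits hs q x) := by
  have hd : Measurable fun x => ((digits hs q x 0 : ℕ) : ℝ) :=
    (measurable_of_countable fun d : Fin s => ((d : ℕ) : ℝ)).comp (measurable_firstDigit hs hq)
  have hint : Integrable (fun x => ((digits hs q x 0 : ℕ) : ℝ)) unitVolume :=
    Integrable.of_bound hd.aestronglyMeasurable (s : ℝ) <| Eventually.of_forall fun x => by
      simp [(digits hs q x 0).2.le]
  have hlaw := strong_law_ae (fun i x => ((digits hs q x i : ℕ) : ℝ)) hint
    (fun i j hij => by
      rcases lt_or_gt_of_ne hij with h | h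
      · exact indepFun_digits hs hq hsum h
      · exact (indepFun_digits hs hq hsum h).symm)
    (identDistrib_digits hs hq hsum)
  filter_upwards [hlaw] with x hx
  refine ⟨_, hx.congr fun n => ?_⟩
  rw [digitAverage, one_div, smul_eq_mul]

theorem volume_qsNoMeanSet (hs : 2 ≤ s) (hq : ∀ i, 0 < q i) (hsum : ∑ i, q i = 1) :
    volume (qsNoMeanSet q) = 0 := by
  have h := ae_hasAverage_digits hs hq hsum
  rw [ae_iff, Measure.restrict_apply' measurableSet_Ico] at h
  refine measure_mono_null (t := _ ∪ {1}) (fun x hx => ?_)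
    (measure_union_null h Real.volume_singleton)
  by_cases hx1 : x = 1
  · exact Or.inr hx1
  · exact Or.inl ⟨(mem_qsNoMeanSet_iff hs hq hsum hx.1).1 hx,
      hx.1.1, lt_of_le_of_ne hx.1.2 hx1⟩

/-! ### Inserting digits into a sequence -/

/-- A digit sequence without asymptotic mean: the digit is `1` on the dyadic blocks
`[2 ^ n, 2 ^ (n + 1))` with `n` even and `0` on the others. -/
theorem exists_not_hasAverage (hs : 2 ≤ s) : ∃ c : ℕ → Fin s, ¬ HasAverage c := by
  let c : ℕ → Fin s := fun j =>
    if Even (Nat.log 2 j) then ⟨1, by omega⟩ else ⟨0, by omega⟩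
  refine ⟨c, ?_⟩
  rintro ⟨r, hr⟩
  -- twice the mean up to `2 ^ (n + 1)` minus the mean up to `2 ^ n` is the mean over the `n`-th block
  have hblock : ∀ n : ℕ, 2 * digitAverage c (2 ^ (n + 1)) - digitAverage c (2 ^ n) =
      if Even n then 1 else 0 := by
    intro n
    have hconst : ∀ j ∈ Finset.Ico (2 ^ n) (2 ^ (n + 1)),
        ((c j : ℕ) : ℝ) = if Even n then 1 else 0 := by
      intro j hj
      rw [Finset.mem_Ico] at hj
      simp only [c, Nat.log_eq_of_pow_le_of_lt_pow hj.1 hj.2]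
      split_ifs <;> simp
    have hsum : ∑ j ∈ Finset.range (2 ^ (n + 1)), ((c j : ℕ) : ℝ) =
        ∑ j ∈ Finset.range (2 ^ n), ((c j : ℕ) : ℝ) + 2 ^ n * if Even n then 1 else 0 := by
      rw [← Finset.sum_range_add_sum_Ico _ (Nat.pow_le_pow_right two_pos n.le_succ),
        Finset.sum_congr rfl hconst, Finset.sum_const, Nat.card_Ico, nsmul_eq_mul, pow_succ,
        mul_two, Nat.add_sub_cancel]
      push_cast
      rfl
    rw [digitAverage, digitAverage, hsum]
    push_cast
    field_simp
    ring
  have hpow : Tendsto (fun n : ℕ => 2 ^ n) atTop atTop :=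
    tendsto_pow_atTop_atTop_of_one_lt one_lt_two
  have hlim : Tendsto (fun n : ℕ => if Even n then (1 : ℝ) else 0) atTop (𝓝 (2 * r - r)) := by
    refine Tendsto.congr hblock (((hr.comp ?_).const_mul 2).sub (hr.comp hpow))
    exact hpow.comp (tendsto_add_atTop_nat 1)
  have heven : Tendsto (fun n : ℕ => 2 * n) atTop atTop :=
    tendsto_id.const_mul_atTop' two_pos
  have h1 := hlim.comp heven
  have h0 := hlim.comp ((tendsto_add_atTop_nat 1).comp heven)
  have e1 := tendsto_nhds_unique h1 (tendsto_const_nhds (x := (1 : ℝ)).congr fun n => by simp)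
  have e0 := tendsto_nhds_unique h0 (tendsto_const_nhds (x := (0 : ℝ)).congr fun n => by simp)
  rw [e1] at e0
  exact one_ne_zero e0

/-- The sequence obtained from `ω` by inserting a digit of the sequence `c` after every `K` digits:
the places `K, 2K + 1, 3K + 2, …` carry `c 0, c 1, c 2, …`, the others the digits of `ω` in
their order. -/
def insertDigits (K : ℕ) (c ω : ℕ → Fin s) (k : ℕ) : Fin s :=
  if k % (K + 1) = K then c (k / (K + 1)) else ω (k - k / (K + 1))

theorem succ_div_of_mod_eq {K n : ℕ} (h : n % (K + 1) = K) :
    (n + 1) / (K + 1) = n / (K + 1) + 1 := by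
  rw [Nat.succ_div, if_pos]
  exact (Nat.dvd_iff_mod_eq_zero).2 (by rw [Nat.add_mod, h]; simp)

theorem succ_div_of_mod_ne {K n : ℕ} (h : n % (K + 1) ≠ K) :
    (n + 1) / (K + 1) = n / (K + 1) := by
  rw [Nat.succ_div, if_neg, add_zero]
  intro hdvd
  obtain ⟨t, ht⟩ := hdvd
  apply h
  have ht0 : t ≠ 0 := by rintro rfl; simp at ht
  obtain ⟨u, rfl⟩ := Nat.exists_eq_succ_of_ne_zero ht0
  have : n = K + (K + 1) * u := by
    have : (K + 1) * (u + 1) = (K + 1) * u + (K + 1) := by ring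
    rw [Nat.succ_eq_add_one] at ht
    omega
  rw [this, Nat.add_mul_mod_self_left, Nat.mod_eq_of_lt (Nat.lt_succ_self K)]

theorem agree_of_insertDigits_agree {K : ℕ} {c ω ω' : ℕ → Fin s} (n : ℕ)
    (h : ∀ k < n, insertDigits K c ω k = insertDigits K c ω' k) :
    ∀ m < n - n / (K + 1), ω m = ω' m := by
  induction n with
  | zero => intro m hm; simp at hm
  | succ n ih =>
    have ih := ih fun k hk => h k (by omega)
    intro m hm
    by_cases hn : n % (K + 1) = K
    · rw [succ_div_of_mod_eq hn] at hm
      exact ih m (by omega)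
    · rw [succ_div_of_mod_ne hn] at hm
      by_cases hlt : m < n - n / (K + 1)
      · exact ih m hlt
      · have hle : n / (K + 1) ≤ n := Nat.div_le_self _ _
        obtain rfl : m = n - n / (K + 1) := by omega
        have := h n (Nat.lt_succ_self n)
        simpa only [insertDigits, if_neg hn] using this

theorem insertDigits_injective {K : ℕ} (hK : 1 ≤ K) (c : ℕ → Fin s) :
    Function.Injective (insertDigits K c) := by
  intro ω ω' h
  ext1 m
  refine agree_of_insertDigits_agree (K := K) (c := c) (2 * m + 2) (fun k _ => by rw [h]) m ?_
  have : (2 * m + 2) / (K + 1) ≤ (2 * m + 2) / 2 := Nat.div_le_div_left (by omega) (by omega)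
  omega

/-- Among the first `n` places `n / (K + 1)` carry inserted digits, and each of them shortens the
interval by a factor of at least `ρ`. -/
theorem le_cylLength_insertDigits (hq : ∀ i, 0 < q i) {ρ : ℝ} (hρ : 0 < ρ)
    (hρq : ∀ i, ρ ≤ q i) (K : ℕ) (c ω : ℕ → Fin s) (n : ℕ) :
    ρ ^ (n / (K + 1)) * cylLength q ω (n - n / (K + 1)) ≤
      cylLength q (insertDigits K c ω) n := by
  induction n with
  | zero => simp [cylLength_zero]
  | succ n ih =>
    rw [cylLength_succ]
    have hle : n / (K + 1) ≤ n := Nat.div_le_self _ _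
    have hpos := cylLength_pos hq ω (n - n / (K + 1))
    by_cases hn : n % (K + 1) = K
    · rw [succ_div_of_mod_eq hn, pow_succ,
        show n + 1 - (n / (K + 1) + 1) = n - n / (K + 1) by omega, mul_right_comm]
      exact mul_le_mul ih (hρq _) hρ.le (cylLength_pos hq _ _).le
    · rw [succ_div_of_mod_ne hn,
        show n + 1 - n / (K + 1) = n - n / (K + 1) + 1 by omega, cylLength_succ, ← mul_assoc]
      simp only [insertDigits, if_neg hn]
      exact mul_le_mul_of_nonneg_right ih (hq _).le

/-- The free digits cancel when two insertions into the same sequence are compared. -/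
theorem sum_insertDigits_sub (K : ℕ) (c c' ω : ℕ → Fin s) (n : ℕ) :
    ∑ k ∈ Finset.range n, ((insertDigits K c ω k : ℕ) : ℝ) -
        ∑ k ∈ Finset.range n, ((insertDigits K c' ω k : ℕ) : ℝ) =
      ∑ j ∈ Finset.range (n / (K + 1)), ((c j : ℕ) : ℝ) -
        ∑ j ∈ Finset.range (n / (K + 1)), ((c' j : ℕ) : ℝ) := by
  induction n with
  | zero => simp
  | succ n ih =>
    by_cases hn : n % (K + 1) = K
    · simp only [succ_div_of_mod_eq hn, Finset.sum_range_succ, insertDigits, if_pos hn]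
      simp only [insertDigits] at ih
      linarith
    · simp only [succ_div_of_mod_ne hn, Finset.sum_range_succ, insertDigits, if_neg hn]
      simp only [insertDigits] at ih
      linarith

/-- Up to place `(K + 1) * n` the averages of the insertions of `c` and of `c'` into the same
sequence differ by `1 / (K + 1)` times the difference of the averages of `c` and `c'` up to `n`. -/
theorem hasAverage_of_hasAverage_insertDigits {K : ℕ} {c c' ω : ℕ → Fin s}
    (h : HasAverage (insertDigits K c ω)) (h' : HasAverage (insertDigits K c' ω))
    (hc' : HasAverage c') : HasAverage c := by
  obtain ⟨r, hr⟩ := h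
  obtain ⟨r', hr'⟩ := h'
  obtain ⟨t, ht⟩ := hc'
  have hmul : Tendsto (fun n : ℕ => (K + 1) * n) atTop atTop :=
    tendsto_id.const_mul_atTop' K.succ_pos
  refine ⟨((K : ℝ) + 1) * (r - r') + t, ?_⟩
  refine ((((hr.sub hr').comp hmul).const_mul ((K : ℝ) + 1)).add ht).congr fun n => ?_
  have hsum := sum_insertDigits_sub K c c' ω ((K + 1) * n)
  rw [Nat.mul_div_cancel_left n K.succ_pos] at hsum
  simp only [Function.comp, digitAverage, ← mul_sub, hsum]
  have hK : (K : ℝ) + 1 ≠ 0 := by positivity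
  push_cast
  rw [← mul_assoc, mul_one_div, ← div_div, div_self hK]
  ring

theorem cylLength_le_pow (hq : ∀ i, 0 < q i) {θ : ℝ} (hθ : ∀ i, q i ≤ θ) (α : ℕ → Fin s)
    (n : ℕ) : cylLength q α n ≤ θ ^ n := by
  have := Finset.prod_le_prod (s := Finset.range n) (fun j _ => (hq (α j)).le)
    fun j _ => hθ (α j)
  simpa [cylLength] using this

/-- Undoing an insertion is a Hölder map of exponent `N / (N + 1)`, provided that `K` is so large
that the `K` free digits before an inserted one shorten an interval by at least the `N`-th power of
the factor `ρ` that the inserted digit may cost. -/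
theorem abs_value_sub_pow_le (hs : 2 ≤ s) (hq : ∀ i, 0 < q i) (hsum : ∑ i, q i = 1) {ρ : ℝ}
    (hρ : 0 < ρ) (hρ1 : ρ < 1) (hρq : ∀ i, ρ ≤ q i ∧ q i ≤ 1 - ρ) {K N : ℕ} (hK : 1 ≤ K)
    (hKN : (1 - ρ) ^ K ≤ ρ ^ N) (c ω ω' : ℕ → Fin s) :
    |value q ω' - value q ω| ^ (N + 1) ≤ ((ρ ^ (K + 2))⁻¹ *
      |value q (insertDigits K c ω') - value q (insertDigits K c ω)|) ^ N := by
  by_cases heq : ω = ω'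
  · subst heq
    simp only [sub_self, abs_zero, mul_zero]
    rw [zero_pow N.succ_ne_zero]
    positivity
  set α := insertDigits K c ω with hα
  set γ := insertDigits K c ω' with hγ
  have hex : ∃ n, α n ≠ γ n := Function.ne_iff.1 ((insertDigits_injective hK c).ne heq)
  classical
  obtain ⟨n, hne, hagree⟩ : ∃ n, α n ≠ γ n ∧ ∀ k < n, α k = γ k :=
    ⟨Nat.find hex, Nat.find_spec hex, fun k hk => not_not.1 (Nat.find_min hex hk)⟩
  -- the next place after `n` with an inserted digit
  have hnK : n % (K + 1) ≠ K := by
    intro h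
    apply hne
    simp only [hα, hγ, insertDigits, if_pos h]
  have hnlt : n % (K + 1) < K + 1 := Nat.mod_lt _ K.succ_pos
  obtain ⟨i, hi⟩ : ∃ i, n % (K + 1) + 1 + i = K := ⟨K - (n % (K + 1) + 1), by omega⟩
  have hmod : (n + 1 + i) % (K + 1) = K := by
    rw [add_assoc, Nat.add_mod, Nat.mod_eq_of_lt (show 1 + i < K + 1 by omega), ← add_assoc, hi,
      Nat.mod_eq_of_lt K.lt_succ_self]
  have hmeet : α (n + 1 + i) = γ (n + 1 + i) := by
    simp only [hα, hγ, insertDigits, if_pos hmod]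
  have hsep := separation hs hq hsum hρ (fun i => (hρq i).1) hagree hne hmeet
  have hpos := cylLength_pos hq α n
  have hsep' : cylLength q α n ≤ (ρ ^ (K + 2))⁻¹ * |value q γ - value q α| := by
    rw [inv_mul_eq_div, le_div_iff₀ (by positivity), mul_comm]
    refine le_trans (mul_le_mul_of_nonneg_right ?_ hpos.le) hsep
    exact pow_le_pow_of_le_one hρ.le hρ1.le (by omega)
  have hins := le_cylLength_insertDigits hq hρ (fun i => (hρq i).1) K c ω n
  have hdiff := abs_value_sub_value_le hq hsum (n - n / (K + 1)) ω ω'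
    (agree_of_insertDigits_agree n hagree)
  have hlpos := cylLength_pos hq ω (n - n / (K + 1))
  -- there are `K` free digits to each inserted one
  have hfree : K * (n / (K + 1)) ≤ n - n / (K + 1) := by
    have : (K + 1) * (n / (K + 1)) ≤ n := Nat.mul_div_le n (K + 1)
    rw [add_mul, one_mul] at this
    omega
  have hsmall : cylLength q ω (n - n / (K + 1)) ≤ (ρ ^ (n / (K + 1))) ^ N := by
    calc cylLength q ω (n - n / (K + 1)) ≤ (1 - ρ) ^ (n - n / (K + 1)) :=
          cylLength_le_pow hq (fun i => (hρq i).2) _ _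
      _ ≤ (1 - ρ) ^ (K * (n / (K + 1))) :=
          pow_le_pow_of_le_one (by linarith) (by linarith) hfree
      _ = ((1 - ρ) ^ K) ^ (n / (K + 1)) := pow_mul _ _ _
      _ ≤ (ρ ^ N) ^ (n / (K + 1)) := pow_le_pow_left₀ (pow_nonneg (by linarith) _) hKN _
      _ = (ρ ^ (n / (K + 1))) ^ N := by rw [← pow_mul, ← pow_mul, mul_comm]
  calc |value q ω' - value q ω| ^ (N + 1) ≤ cylLength q ω (n - n / (K + 1)) ^ (N + 1) :=
        pow_le_pow_left₀ (abs_nonneg _) hdiff _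
    _ ≤ (ρ ^ (n / (K + 1)) * cylLength q ω (n - n / (K + 1))) ^ N := by
        rw [pow_succ', mul_pow]
        exact mul_le_mul_of_nonneg_right hsmall (by positivity)
    _ ≤ cylLength q α n ^ N := pow_le_pow_left₀ (by positivity) hins _
    _ ≤ _ := pow_le_pow_left₀ hpos.le hsep' _

/-! ### Dimension and cardinality -/

/-- A Hölder estimate between two parametrizations `u`, `v` provides a Hölder map from the range
of `v` to that of `u`. -/
theorem exists_holderOnWith {ι : Type*} {u v : ι → ℝ} {C : ℝ} (hC : 0 ≤ C) {N : ℕ} (hN : 1 ≤ N)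
    (h : ∀ i j, |u i - u j| ^ (N + 1) ≤ (C * |v i - v j|) ^ N) (I : Set ι) :
    ∃ (D : NNReal) (f : ℝ → ℝ), HolderOnWith D ((N : NNReal) / (N + 1)) f (v '' I) ∧
      f '' (v '' I) = u '' I := by
  classical
  -- the estimate forces `u i = u j` whenever `v i = v j`, so the choice of index is immaterial
  let f : ℝ → ℝ := fun x => if hx : ∃ i, v i = x then u hx.choose else 0
  have hf : ∀ i, f (v i) = u i := by
    intro i
    have hx : ∃ j, v j = v i := ⟨i, rfl⟩
    have h1 := h hx.choose i
    rw [hx.choose_spec, sub_self, abs_zero, mul_zero, zero_pow (by omega)] at h1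
    have h2 : |u hx.choose - u i| = 0 :=
      pow_eq_zero_iff N.succ_ne_zero |>.1 (le_antisymm h1 (by positivity))
    simp only [f, dif_pos hx]
    exact sub_eq_zero.1 (abs_eq_zero.1 h2)
  have hr : (0 : ℝ) ≤ (N : ℝ) / (N + 1) := by positivity
  refine ⟨(C ^ ((N : ℝ) / (N + 1))).toNNReal, f, ?_, ?_⟩
  · rintro _ ⟨i, -, rfl⟩ _ ⟨j, -, rfl⟩
    rw [hf, hf, edist_dist, edist_dist, Real.dist_eq, Real.dist_eq]
    have hpow : |u i - u j| ≤ C ^ ((N : ℝ) / (N + 1)) * |v i - v j| ^ ((N : ℝ) / (N + 1)) := by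
      rw [← Real.mul_rpow hC (abs_nonneg _), div_eq_mul_inv,
        Real.rpow_mul (by positivity), Real.rpow_natCast]
      have := Real.rpow_le_rpow (by positivity) (h i j)
        (show (0 : ℝ) ≤ ((N : ℝ) + 1)⁻¹ by positivity)
      refine le_trans (le_of_eq ?_) this
      have := Real.pow_rpow_inv_natCast (abs_nonneg (u i - u j)) N.succ_ne_zero
      push_cast at this
      exact this.symm
    have hcoe : (((N : NNReal) / (N + 1) : NNReal) : ℝ) = (N : ℝ) / (N + 1) := by push_cast; rfl
    rw [hcoe, ENNReal.ofReal_rpow_of_nonneg (abs_nonneg _) hr]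
    change _ ≤ ENNReal.ofReal _ * _
    rw [← ENNReal.ofReal_mul (Real.rpow_nonneg hC _)]
    exact ENNReal.ofReal_le_ofReal hpow
  · rw [Set.image_image]
    exact Set.image_congr fun i _ => hf i

/-- The unit interval is covered by the images of two subsets of `qsNoMeanSet q` under Hölder maps
of exponent arbitrarily close to `1`. -/
theorem exists_holder_cover (hs : 2 ≤ s) (hq : ∀ i, 0 < q i) (hsum : ∑ i, q i = 1) {N : ℕ}
    (hN : 1 ≤ N) :
    ∃ (A B : Set ℝ) (C D : NNReal) (f g : ℝ → ℝ), A ⊆ qsNoMeanSet q ∧ B ⊆ qsNoMeanSet q ∧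
      HolderOnWith C ((N : NNReal) / (N + 1)) f A ∧ HolderOnWith D ((N : NNReal) / (N + 1)) g B ∧
      Set.Icc 0 1 ⊆ f '' A ∪ g '' B := by
  obtain ⟨ρ, hρ, hρ1, hρq⟩ := exists_bounds hs hq hsum
  obtain ⟨K, hK1, hK⟩ : ∃ K : ℕ, 1 ≤ K ∧ (1 - ρ) ^ K ≤ ρ ^ N := by
    have hlim := tendsto_pow_atTop_nhds_zero_of_lt_one (r := 1 - ρ) (by linarith) (by linarith)
    exact ((eventually_ge_atTop 1).and (hlim.eventually_le_const (by positivity))).exists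
  obtain ⟨c, hc⟩ := exists_not_hasAverage hs
  let z : ℕ → Fin s := fun _ => ⟨0, by omega⟩
  have hz : HasAverage z :=
    ⟨_, tendsto_digitAverage_of_eventually_eq (d := 0) (N := 0) fun n _ => rfl⟩
  have hholder := fun e : ℕ → Fin s => exists_holderOnWith (u := value q)
    (v := fun ω => value q (insertDigits K e ω)) (C := (ρ ^ (K + 2))⁻¹) (by positivity) hN
    (fun ω' ω => abs_value_sub_pow_le hs hq hsum hρ hρ1 hρq hK1 hK e ω ω')
    {ω | ¬ HasAverage (insertDigits K e ω)}
  have hsub : ∀ e : ℕ → Fin s, (fun ω => value q (insertDigits K e ω)) ''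
      {ω | ¬ HasAverage (insertDigits K e ω)} ⊆ qsNoMeanSet q := by
    rintro e _ ⟨ω, hω, rfl⟩
    exact (value_mem_qsNoMeanSet_iff hs hq hsum).2 hω
  obtain ⟨C, f, hf, hfim⟩ := hholder c
  obtain ⟨D, g, hg, hgim⟩ := hholder z
  refine ⟨_, _, C, D, f, g, hsub c, hsub z, hf, hg, fun x hx => ?_⟩
  rw [hfim, hgim, ← value_digits hs hq hsum hx]
  by_cases h : HasAverage (insertDigits K c (digits hs q x))
  · exact Or.inr ⟨_, fun h' => hc (hasAverage_of_hasAverage_insertDigits h h' hz), rfl⟩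
  · exact Or.inl ⟨_, h, rfl⟩

theorem dimH_qsNoMeanSet (hs : 2 ≤ s) (hq : ∀ i, 0 < q i) (hsum : ∑ i, q i = 1) :
    dimH (qsNoMeanSet q) = 1 := by
  refine le_antisymm ((dimH_mono (Set.subset_univ _)).trans Real.dimH_univ.le) ?_
  have hI : dimH (Set.Icc (0 : ℝ) 1) = 1 := by
    rw [Real.dimH_of_nonempty_interior (by simp), Module.finrank_self, Nat.cast_one]
  have hle : ∀ N : ℕ, ((((N + 1 : ℕ) : NNReal) / ((N + 1 : ℕ) + 1) : NNReal) : ENNReal) ≤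
      dimH (qsNoMeanSet q) := by
    intro N
    obtain ⟨A, B, C, D, f, g, hA, hB, hf, hg, hcov⟩ :=
      exists_holder_cover hs hq hsum (N := N + 1) (by omega)
    have hr : 0 < ((N + 1 : ℕ) : NNReal) / ((N + 1 : ℕ) + 1) := by positivity
    have h1 := dimH_mono hcov
    rw [hI, dimH_union] at h1
    have h2 := h1.trans (max_le
      ((hf.dimH_image_le hr).trans (ENNReal.div_le_div_right (dimH_mono hA) _))
      ((hg.dimH_image_le hr).trans (ENNReal.div_le_div_right (dimH_mono hB) _)))
    rwa [ENNReal.le_div_iff_mul_le (Or.inl (by exact_mod_cast hr.ne'))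
      (Or.inl ENNReal.coe_ne_top), one_mul] at h2
  have hlim : Tendsto (fun N : ℕ => ((N + 1 : ℕ) : NNReal) / ((N + 1 : ℕ) + 1)) atTop (𝓝 1) := by
    rw [← NNReal.tendsto_coe]
    have := (tendsto_natCast_div_add_atTop (1 : ℝ)).comp (tendsto_add_atTop_nat 1)
    simpa [Function.comp_def] using this
  exact le_of_tendsto' (ENNReal.tendsto_coe.2 hlim) hle

theorem mk_qsNoMeanSet (hs : 2 ≤ s) (hq : ∀ i, 0 < q i) (hsum : ∑ i, q i = 1) :
    Cardinal.mk (qsNoMeanSet q) = Cardinal.continuum := by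
  refine le_antisymm ((Cardinal.mk_set_le _).trans Cardinal.mk_real.le) ?_
  obtain ⟨A, B, -, -, f, g, hA, hB, -, -, hcov⟩ :=
    exists_holder_cover hs hq hsum (N := 1) le_rfl
  have h : Cardinal.continuum ≤ Cardinal.mk (qsNoMeanSet q) + Cardinal.mk (qsNoMeanSet q) := by
    rw [← Cardinal.mk_Icc_real (zero_lt_one (α := ℝ))]
    exact (Cardinal.mk_le_mk_of_subset hcov).trans <| (Cardinal.mk_union_le _ _).trans <|
      add_le_add (Cardinal.mk_image_le.trans (Cardinal.mk_le_mk_of_subset hA))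
        (Cardinal.mk_image_le.trans (Cardinal.mk_le_mk_of_subset hB))
  have hinf : Cardinal.aleph0 ≤ Cardinal.mk (qsNoMeanSet q) := by
    by_contra! hlt
    exact absurd (h.trans_lt (Cardinal.add_lt_aleph0 hlt hlt))
      (not_lt.2 Cardinal.aleph0_le_continuum)
  rwa [Cardinal.add_eq_self hinf] at h

/-! ### Density -/

/-- Prepending a digit to a point of `qsNoMeanSet q` gives a point of `qsNoMeanSet q`. -/
theorem qsBeta_add_mul_mem_qsNoMeanSet (hs : 2 ≤ s) (hq : ∀ i, 0 < q i) (hsum : ∑ i, q i = 1)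
    {x : ℝ} (hx : x ∈ qsNoMeanSet q) (j : Fin s) : qsBeta q j + q j * x ∈ qsNoMeanSet q := by
  let α : ℕ → Fin s := fun k => Nat.casesOn k j (digits hs q x)
  have hα : value q α = qsBeta q j + q j * x := by
    rw [value_eq hq hsum α]
    change qsBeta q j + q j * value q (digits hs q x) = _
    rw [value_digits hs hq hsum hx.1]
  rw [← hα, value_mem_qsNoMeanSet_iff hs hq hsum]
  exact fun h => (mem_qsNoMeanSet_iff hs hq hsum hx.1).1 hx h.tail

theorem Icc_subset_closure_qsNoMeanSet (hs : 2 ≤ s) (hq : ∀ i, 0 < q i) (hsum : ∑ i, q i = 1) :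
    Set.Icc (0 : ℝ) 1 ⊆ closure (qsNoMeanSet q) := by
  obtain ⟨ρ, hρ, hρ1, hρq⟩ := exists_bounds hs hq hsum
  have key : ∀ n : ℕ, ∀ y ∈ Set.Icc (0 : ℝ) 1, ∃ x ∈ qsNoMeanSet q, |y - x| ≤ (1 - ρ) ^ n := by
    intro n
    induction n with
    | zero =>
      intro y hy
      obtain ⟨c, hc⟩ := exists_not_hasAverage hs
      have hx := (value_mem_qsNoMeanSet_iff hs hq hsum).2 hc
      refine ⟨_, hx, ?_⟩
      rw [pow_zero, abs_le]
      constructor <;> linarith [hy.1, hy.2, hx.1.1, hx.1.2]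
    | succ n ih =>
      intro y hy
      obtain ⟨x, hx, hxy⟩ := ih _ (digitShift_mem_Icc hs hq hsum hy)
      refine ⟨_, qsBeta_add_mul_mem_qsNoMeanSet hs hq hsum hx (firstDigit hs q y), ?_⟩
      have : y - (qsBeta q (firstDigit hs q y) + q (firstDigit hs q y) * x) =
          q (firstDigit hs q y) * (digitShift hs q y - x) := by
        linarith [qsBeta_add_mul_digitShift hs hq y]
      rw [this, abs_mul, abs_of_pos (hq _), pow_succ']
      exact mul_le_mul (hρq _).2 hxy (abs_nonneg _) (by linarith)
  intro y hy
  rw [Metric.mem_closure_iff]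
  intro ε hε
  have hlim := tendsto_pow_atTop_nhds_zero_of_lt_one (r := 1 - ρ) (by linarith) (by linarith)
  obtain ⟨n, hn⟩ := (hlim.eventually_lt_const hε).exists
  obtain ⟨x, hx, hxy⟩ := key n y hy
  exact ⟨x, hx, by rw [Real.dist_eq]; exact hxy.trans_lt hn⟩

end QsExpansion

theorem mainTheorem1 (s : ℕ) (hs : 2 ≤ s) (q : Fin s → ℝ)
    (hq_pos : ∀ i, 0 < q i) (hq_sum : ∑ i, q i = 1) :
    Cardinal.mk (qsNoMeanSet q) = Cardinal.continuum ∧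
    Set.Icc (0 : ℝ) 1 ⊆ closure (qsNoMeanSet q) ∧
    (∀ a b : ℝ, a < b → ¬ Set.Ioo a b ⊆ qsNoMeanSet q) ∧
    MeasureTheory.volume (qsNoMeanSet q) = 0 ∧
    dimH (qsNoMeanSet q) = 1 := by
  have hnull := QsExpansion.volume_qsNoMeanSet hs hq_pos hq_sum
  refine ⟨QsExpansion.mk_qsNoMeanSet hs hq_pos hq_sum,
    QsExpansion.Icc_subset_closure_qsNoMeanSet hs hq_pos hq_sum, fun a b hab hsub => ?_,
    hnull, QsExpansion.dimH_qsNoMeanSet hs hq_pos hq_sum⟩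
  have h := MeasureTheory.measure_mono_null hsub hnull
  rw [Real.volume_Ioo, ENNReal.ofReal_eq_zero] at h
  linarith
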